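/- Let $n\ge 1$, $e\in\mathbb R^n$, $\bar k_1,\dots,\bar k_n\in\mathbb R$ and $\eta_1,c_0>0$. Let $d_i(x_i,x_{i+1})$ $(1\le i\le n-1)$ and $d_n(x_n)$ be $C^1$ real functions that vanish at $x=e$ and satisfy, everywhere on $\mathbb R^n$, $$\frac{\partial d_i}{\partial x_i}>0,\qquad \frac{\partial d_i}{\partial x_{i+1}}<0\ (i<n),\qquad \frac{\partial d_i}{\partial x_i}+\frac{\partial d_i}{\partial x_{i+1}}\ge\eta_1,\qquad \max\Big\{\Big|\frac{\partial d_i}{\partial x_i}\Big|,\Big|\frac{\partial d_i}{\partial x_{i+1}}\Big|\Big\}\le c_0 ,$$ where $\partial d_n/\partial x_{n+1}:=0$. Put $f=(-d_1,\dots,-d_n)^T$ and $h_i=\sum_{j=1}^{i-1}d_j$. Let $G\in\mathbb R^{n\times n}$ have entries $G_{ii}=-1$, $G_{j+1,j}=1$ and $0$ otherwise, and, for a communication range $r\in\{1,\dots,n\}$, let $A\in\mathbb R^{n\times n}$ have entries $A_{ii}=-\bar k_i$, $A_{j+r,j}=\bar k_{j+r}$ and $0$ otherwise. For $\epsilon>0$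 and a disturbance $w:[0,\infty)\to\mathbb R^n$ consider the system $$\dot x=f(x)+Gy,\qquad \epsilon\,\dot y=Ay-\epsilon\,\frac{\partial h}{\partial x}(x)\,\big(f(x)+Gy\big)+\epsilon w .$$ Solutions are understood in the Carathéodory sense. Write $|\cdot|_\infty$ for the maximum norm on $\mathbb R^n$, $\|u\|=\operatorname{ess\,sup}_{t\ge0}|u(t)|$ for scalar signals and $\|w\|_\infty=\operatorname{ess\,sup}_{t\ge 0}|w(t)|_\infty$. Then there is a constant $c>0$, the same for all $r$, such that the following holds for every $r\in\{1,\dots,n\}$ for which some $\bar\epsilon>0$ satisfies $-\bar k_i+2\bar\epsilon c_0(r-1)<0$ for all $i=1,\dots,n$. For every $\sigma>0$, every measurable essentially bounded $w$ and every bounded set $\Omega\subset\mathbb R^{2n}$ there exists $\epsilon^*>0$ such that, for every $\epsilon\in(0,\epsilon^*]$ and every initial condition $(x(0),y(0))\in\Omega$, the system has a solution on $[0,\infty)$, and every such solution satisfies $$\|x_i-e_i\|\le|x(0)-e|_\infty+\epsilon\,c\,\sqrt{\lceil n/r\rceil}\,\|w\|_\infty+\sigma,\qquad i=1,\dots,n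 .$$ -/

import Mathlib

open MeasureTheory

noncomputable section

namespace Platoon

/-- The successor coordinate `x_{i+1}`. For the last index the value is an irrelevant default,
because the last spacing map does not depend on its second argument. -/
def next {n : ℕ} (x : Fin n → ℝ) (i : Fin n) : ℝ :=
  if h : (i : ℕ) + 1 < n then x ⟨(i : ℕ) + 1, h⟩ else 0

/-- The value `d_i(x_i, x_{i+1})` (which is `d_n(x_n)` for the last index). -/
def dval {n : ℕ} (d : Fin n → ℝ × ℝ → ℝ) (x : Fin n → ℝ) (i : Fin n) : ℝ :=
  d i (x i, next x i)

/-- Partial derivative with respect to the first argument. -/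
def partial₁ (g : ℝ × ℝ → ℝ) (p : ℝ × ℝ) : ℝ := deriv (fun s => g (s, p.2)) p.1

/-- Partial derivative with respect to the second argument. -/
def partial₂ (g : ℝ × ℝ → ℝ) (p : ℝ × ℝ) : ℝ := deriv (fun s => g (p.1, s)) p.2

/-- The standing conditions on the mappings `d_i`: they are `C¹`, vanish at the desired spacing
`e`, the last one depends on its first argument only, and the sign, row-sum and boundedness
conditions on the partial derivatives hold everywhere. -/
structure Admissible {n : ℕ} (d : Fin n → ℝ × ℝ → ℝ) (e : Fin n → ℝ) (η₁ c : ℝ) : Prop where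
  contDiff : ∀ i, ContDiff ℝ 1 (d i)
  last : ∀ i : Fin n, (i : ℕ) + 1 = n → ∀ u v v' : ℝ, d i (u, v) = d i (u, v')
  equilibrium : ∀ i, dval d e i = 0
  pos : ∀ i p, 0 < partial₁ (d i) p
  neg : ∀ i : Fin n, (i : ℕ) + 1 < n → ∀ p, partial₂ (d i) p < 0
  sum_ge : ∀ i p, η₁ ≤ partial₁ (d i) p + partial₂ (d i) p
  bound : ∀ i p, max |partial₁ (d i) p| |partial₂ (d i) p| ≤ c

/-- The reduced vector field `f = (-d_1, …, -d_n)`. -/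
def f {n : ℕ} (d : Fin n → ℝ × ℝ → ℝ) (x : Fin n → ℝ) : Fin n → ℝ := fun i => -dval d x i

/-- The quasi-steady state `h_i = d_1 + ⋯ + d_{i-1}`. -/
def h {n : ℕ} (d : Fin n → ℝ × ℝ → ℝ) (x : Fin n → ℝ) : Fin n → ℝ :=
  fun i => ∑ j ∈ Finset.Iio i, dval d x j

/-- The matrix `G`. -/
def G (n : ℕ) : Matrix (Fin n) (Fin n) ℝ :=
  fun i j => if i = j then -1 else if (i : ℕ) = (j : ℕ) + 1 then 1 else 0

/-- The matrix `A` for the relative gains `kbar` and the communication range `r`. -/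
def A {n : ℕ} (kbar : Fin n → ℝ) (r : ℕ) : Matrix (Fin n) (Fin n) ℝ :=
  fun i j => if i = j then -kbar i else if (i : ℕ) = (j : ℕ) + r then kbar i else 0

/-- Right-hand side of the slow equation `dx/dt = f(x) + G y`. -/
def slow {n : ℕ} (d : Fin n → ℝ × ℝ → ℝ) (x y : Fin n → ℝ) : Fin n → ℝ :=
  f d x + (G n).mulVec y

/-- Right-hand side of the fast equation
`dy/dτ = A y - ε (∂h/∂x) (f(x) + G y) + ε w`, where `τ = t / ε`. -/
def fast {n : ℕ} (d : Fin n → ℝ × ℝ → ℝ) (kbar : Fin n → ℝ) (r : ℕ) (ε : ℝ)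
    (x y w : Fin n → ℝ) : Fin n → ℝ :=
  (A kbar r).mulVec y - ε • fderiv ℝ (h d) x (slow d x y) + ε • w

/-- `(x, y)` is a (Carathéodory) solution on `[0, ∞)` of the `(x, y)`-system with disturbance `w`:
`x`, `y` are continuous and satisfy the integrated equations, in the original time
`t = ε τ`. -/
structure IsSolution {n : ℕ} (d : Fin n → ℝ × ℝ → ℝ) (kbar : Fin n → ℝ) (r : ℕ) (ε : ℝ)
    (w x y : ℝ → Fin n → ℝ) : Prop where
  cont_x : ContinuousOn x (Set.Ici 0)
  cont_y : ContinuousOn y (Set.Ici 0)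
  eq_x : ∀ t, 0 ≤ t → x t = x 0 + ∫ s in (0 : ℝ)..t, slow d (x s) (y s)
  eq_y : ∀ t, 0 ≤ t →
    y t = y 0 + ∫ s in (0 : ℝ)..t, ε⁻¹ • fast d kbar r ε (x s) (y s) (w s)

/-- The signal norm `ess sup_{t ≥ 0} |u(t)|`. For `E = Fin n → ℝ` the norm of `E` is `|·|_∞`. -/
def signalNorm {E : Type*} [NormedAddCommGroup E] (u : ℝ → E) : ENNReal :=
  eLpNorm u ⊤ (volume.restrict (Set.Ici 0))

/-- `u` is a measurable, essentially bounded signal on `[0, ∞)`. -/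
def EssBounded {E : Type*} [NormedAddCommGroup E] (u : ℝ → E) : Prop :=
  MemLp u ⊤ (volume.restrict (Set.Ici 0))

end Platoon

end

/-! ### Barrier comparison and continuation for integral equations. -/

namespace Platoon

open Set Filter Topology

/-! The system is a singular perturbation in which `ε` is chosen after `w`, `Ω` and `σ`, so explicit
but crude barriers suffice. The condition on `εbar` enters only through its consequence that all
gains are positive, hence at least some `k > 0`.

Fast variable (`norm_fast_variable_le`): row `i` of `A` damps `y_i` with rate `kbar i` and is driven
by `y_{i-r}` with the same gain. With barrier weights `2 ^ i` the predecessor cancels at most half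
of the damping, whatever `r ≥ 1` is. So `y` decays at rate `k / (2 ε)` down to a residual of order
`ε`.

Slow variable (`norm_sub_le_add_integral_exp_bound`): where the error of `x_i` exceeds a barrier
that also bounds its successor's error, the sign and row-sum conditions give a restoring force of at
least `η₁` times that error. It absorbs the residual of `y`; the initial layer of `y` integrates to
`O(ε)`.

The forcing of the fast equation contains the derivative of `h` along the flow, which is bounded
only while `x` and `y` are. A continuation argument (`IsSolution.norm_spacing_error_le`) closes this
loop for small `ε`. The term proportional to the norm of `w` gives the constant, the remaining
`O(ε)` terms go into `σ`, and the square root is used only through being at least `1`. -/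

theorem continuousOn_of_eq_add_integral {u g : ℝ → ℝ} {T : ℝ} (hT : 0 ≤ T)
    (hu : ∀ t ∈ Icc 0 T, u t = u 0 + ∫ s in (0 : ℝ)..t, g s)
    (hg : IntervalIntegrable g volume 0 T) : ContinuousOn u (Icc 0 T) := by
  have h1 : ContinuousOn (fun t => u 0 + ∫ s in (0 : ℝ)..t, g s) (Icc 0 T) := by
    have := intervalIntegral.continuousOn_primitive_interval' hg (left_mem_uIcc)
    rw [uIcc_of_le hT] at this
    exact continuousOn_const.add this
  exact h1.congr hu

/-- A primitive of `g` starting below `B` stays below `B` if its slope is at most that of `B`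
wherever it exceeds `B`. -/
theorem le_barrier_of_integral {u g B B' : ℝ → ℝ} {T : ℝ}
    (hu : ∀ t ∈ Icc 0 T, u t = u 0 + ∫ s in (0 : ℝ)..t, g s)
    (hg : IntervalIntegrable g volume 0 T)
    (hB : ∀ t, HasDerivAt B (B' t) t) (hB' : Continuous B') (h0 : u 0 ≤ B 0)
    (hle : ∀ᵐ s, s ∈ Icc 0 T → B s < u s → g s ≤ B' s) :
    ∀ t ∈ Icc 0 T, u t ≤ B t := by
  intro t ht
  have hT : 0 ≤ T := ht.1.trans ht.2
  have huc := continuousOn_of_eq_add_integral hT hu hg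
  have hBc : Continuous B := continuous_iff_continuousAt.2 fun t => (hB t).continuousAt
  by_contra! hlt
  have hsub : Icc 0 t ⊆ Icc 0 T := Icc_subset_Icc_right ht.2
  have hcl : IsClosed {s ∈ Icc 0 t | u s ≤ B s} :=
    isClosed_Icc.isClosed_le (huc.mono hsub) hBc.continuousOn
  have hcpt : IsCompact {s ∈ Icc 0 t | u s ≤ B s} :=
    isCompact_Icc.of_isClosed_subset hcl (sep_subset _ _)
  -- The last time before `t` at which `u ≤ B`: from `a` to `t` the slope bound applies almost
  -- everywhere, and integrating it contradicts `B t < u t`.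
  obtain ⟨a, ⟨ha, hua⟩, hamax⟩ := hcpt.exists_isGreatest ⟨0, ⟨le_rfl, ht.1⟩, h0⟩
  have hgt : ∀ s ∈ Icc 0 t, a < s → B s < u s := fun s hs has => by
    by_contra! hc
    exact absurd (hamax ⟨hs, hc⟩) (not_le.2 has)
  have hga : IntervalIntegrable g volume 0 a :=
    hg.mono_set (by rw [uIcc_of_le ha.1, uIcc_of_le hT]; exact Icc_subset_Icc_right (ha.2.trans ht.2))
  have hgt' : IntervalIntegrable g volume 0 t :=
    hg.mono_set (by rw [uIcc_of_le ht.1, uIcc_of_le hT]; exact hsub)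
  have hgat := hga.symm.trans hgt'
  have hdiff : u t - u a = ∫ s in a..t, g s := by
    rw [hu t ht, hu a (hsub ha), ← intervalIntegral.integral_interval_sub_left hgt' hga]
    ring
  have hBint : ∫ s in a..t, B' s = B t - B a :=
    intervalIntegral.integral_eq_sub_of_hasDerivAt (fun s _ => hB s) (hB'.intervalIntegrable _ _)
  have hmono : ∫ s in a..t, g s ≤ ∫ s in a..t, B' s := by
    refine intervalIntegral.integral_mono_ae_restrict ha.2 hgat (hB'.intervalIntegrable _ _) ?_
    rw [EventuallyLE, ae_restrict_iff' measurableSet_Icc]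
    have hne : ∀ᵐ s : ℝ, s ≠ a := by simp [ae_iff]
    filter_upwards [hle, hne] with s hs hsa hmem
    have hmem' : s ∈ Icc 0 t := ⟨ha.1.trans hmem.1, hmem.2⟩
    exact hs (hsub hmem') (hgt s hmem' (lt_of_le_of_ne hmem.1 (Ne.symm hsa)))
  linarith

theorem abs_le_barrier_of_integral {u g B B' : ℝ → ℝ} {T : ℝ}
    (hu : ∀ t ∈ Icc 0 T, u t = u 0 + ∫ s in (0 : ℝ)..t, g s)
    (hg : IntervalIntegrable g volume 0 T)
    (hB : ∀ t, HasDerivAt B (B' t) t) (hB' : Continuous B') (h0 : |u 0| ≤ B 0)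
    (hle : ∀ᵐ s, s ∈ Icc 0 T → B s < u s → g s ≤ B' s)
    (hge : ∀ᵐ s, s ∈ Icc 0 T → u s < -B s → -B' s ≤ g s) :
    ∀ t ∈ Icc 0 T, |u t| ≤ B t := by
  intro t ht
  rw [abs_le'] at h0 ⊢
  refine ⟨le_barrier_of_integral hu hg hB hB' h0.1 hle t ht, ?_⟩
  refine le_barrier_of_integral (u := fun s => -u s) (g := fun s => -g s) (fun s hs => ?_) hg.neg
    hB hB' h0.2 ?_ t ht
  · rw [intervalIntegral.integral_neg, hu s hs]; ring
  · filter_upwards [hge] with s hs hmem hlt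
    linarith [hs hmem (by linarith)]

/-- A continuous function on `[0, ∞)` is nonpositive if nonpositivity on `[0, T]` always implies
negativity at `T`, and it starts nonpositive. -/
theorem nonpos_of_forall_nonpos_imp_neg {q : ℝ → ℝ} (hq : ContinuousOn q (Ici 0)) (h0 : q 0 ≤ 0)
    (hstep : ∀ T, 0 ≤ T → (∀ t ∈ Icc 0 T, q t ≤ 0) → q T < 0) : ∀ t, 0 ≤ t → q t ≤ 0 := by
  intro T hT
  by_contra! hcon
  have hcpt : IsCompact {s ∈ Icc 0 T | 0 ≤ q s} :=
    isCompact_Icc.of_isClosed_subset (isClosed_Icc.isClosed_le continuousOn_const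
      (hq.mono fun _ h => h.1)) (sep_subset _ _)
  -- The first time at which `q ≥ 0`; before it `q < 0`, so `hstep` at `a` gives a contradiction.
  obtain ⟨a, ⟨ha, hqa⟩, hamin⟩ := hcpt.exists_isLeast ⟨T, ⟨hT, le_rfl⟩, hcon.le⟩
  have hlt : ∀ s ∈ Ico 0 a, q s < 0 := fun s hs => by
    by_contra! hc
    exact absurd (hamin ⟨⟨hs.1, hs.2.le.trans ha.2⟩, hc⟩) (not_le.2 hs.2)
  have hqa0 : q a ≤ 0 := by
    rcases ha.1.eq_or_lt with h | h
    · rw [← h]; exact h0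
    · have hc : ContinuousWithinAt q (Ico 0 a) a := (hq a ha.1).mono fun _ h => h.1
      have : (𝓝[Ico 0 a] a).NeBot := by
        rw [← mem_closure_iff_nhdsWithin_neBot, closure_Ico h.ne]
        exact ⟨h.le, le_rfl⟩
      exact le_of_tendsto hc (eventually_nhdsWithin_of_forall fun s hs => (hlt s hs).le)
  refine absurd (hstep a ha.1 fun t ht => ?_) (not_lt.2 hqa)
  rcases ht.2.eq_or_lt with h | h
  · rw [h]; exact hqa0
  · exact (hlt t ⟨ht.1, h⟩).le

/-! ### Global existence for Lipschitz integral equations. -/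

section GlobalExistence

variable {E : Type*} [NormedAddCommGroup E] [NormedSpace ℝ E]

theorem norm_integral_le_of_norm_le_mul_exp {φ : ℝ → E} {a b t : ℝ} (ha : 0 < a) (hb : 0 ≤ b)
    (ht : 0 ≤ t) (hφ : ∀ s ∈ Icc 0 t, ‖φ s‖ ≤ b * Real.exp (a * s)) :
    ‖∫ s in (0 : ℝ)..t, φ s‖ ≤ b / a * Real.exp (a * t) := by
  have hc : Continuous fun s : ℝ => b * Real.exp (a * s) := by fun_prop
  have hint : ∫ s in (0 : ℝ)..t, b * Real.exp (a * s)
      = b / a * Real.exp (a * t) - b / a * Real.exp (a * 0) := by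
    refine intervalIntegral.integral_eq_sub_of_hasDerivAt (f := fun s => b / a * Real.exp (a * s))
      (fun s _ => ?_) (hc.intervalIntegrable _ _)
    have h1 : HasDerivAt (fun s => a * s) a s := by simpa using (hasDerivAt_id s).const_mul a
    have h2 := h1.exp.const_mul (b / a)
    rwa [mul_comm (Real.exp _) a, ← mul_assoc, div_mul_cancel₀ b ha.ne'] at h2
  have hle : ‖∫ s in (0 : ℝ)..t, φ s‖ ≤ ∫ s in (0 : ℝ)..t, b * Real.exp (a * s) :=
    intervalIntegral.norm_integral_le_of_norm_le ht
      (Eventually.of_forall fun s hs => hφ s (Ioc_subset_Icc_self hs)) (hc.intervalIntegrable _ _)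
  rw [hint] at hle
  have : 0 ≤ b / a * Real.exp (a * 0) := by positivity
  linarith

open scoped NNReal BoundedContinuousFunction

/-- Global solvability of `u = g + ∫₀ F(u)` for a globally Lipschitz `F` and a forcing `g` of
exponential growth. -/
theorem exists_eq_add_integral_of_lipschitz [CompleteSpace E] {F : E → E} {K : ℝ≥0}
    (hF : LipschitzWith K F) {g : ℝ → E} (hg : Continuous g) {b : ℝ}
    (hgb : ∀ t, 0 ≤ t → ‖g t‖ ≤ b * Real.exp t) :
    ∃ u : ℝ → E, Continuous u ∧ ∀ t, 0 ≤ t → u t = g t + ∫ s in (0 : ℝ)..t, F (u s) := by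
  set a : ℝ := K + 1 with ha_def
  have ha : 0 < a := by positivity
  have hb : 0 ≤ b := by
    have := (norm_nonneg _).trans (hgb 0 le_rfl)
    simpa using this
  -- The Picard map for `v t = exp (-a t) • u t`. The exponential weight gives contraction factor `K
  -- / a < 1` on the whole half-line at once; `max t 0` extends the map to negative times.
  let Ψ : (ℝ →ᵇ E) → ℝ → E := fun v t =>
    Real.exp (-(a * max t 0)) • (g (max t 0)
      + ∫ s in (0 : ℝ)..max t 0, F (Real.exp (a * s) • v s))
  have hcont : ∀ v : ℝ →ᵇ E, Continuous fun s => F (Real.exp (a * s) • v s) := fun v =>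
    hF.continuous.comp (by fun_prop)
  have hΨc : ∀ v, Continuous (Ψ v) := fun v => by
    have h1 : Continuous fun t : ℝ => ∫ s in (0 : ℝ)..t, F (Real.exp (a * s) • v s) :=
      intervalIntegral.continuous_primitive (fun x y => (hcont v).intervalIntegrable x y) 0
    have hm : Continuous fun t : ℝ => max t 0 := by fun_prop
    exact (by fun_prop : Continuous fun t : ℝ => Real.exp (-(a * max t 0))).smul
      ((hg.comp hm).add (h1.comp hm))
  have hΨb : ∀ v : ℝ →ᵇ E, ∀ t, ‖Ψ v t‖ ≤ b + (‖F 0‖ + K * ‖v‖) / a := fun v t => by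
    set τ := max t 0 with hτ
    have hτ0 : 0 ≤ τ := le_max_right _ _
    have h1 : ‖∫ s in (0 : ℝ)..τ, F (Real.exp (a * s) • v s)‖
        ≤ (‖F 0‖ + K * ‖v‖) / a * Real.exp (a * τ) := by
      refine norm_integral_le_of_norm_le_mul_exp ha (by positivity) hτ0 fun s hs => ?_
      have h2 := hF.norm_sub_le (Real.exp (a * s) • v s) 0
      rw [sub_zero, norm_smul, Real.norm_eq_abs, Real.abs_exp] at h2
      have h3 : ‖F (Real.exp (a * s) • v s)‖ ≤ ‖F 0‖ + ‖F (Real.exp (a * s) • v s) - F 0‖ := by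
        simpa using norm_add_le (F 0) (F (Real.exp (a * s) • v s) - F 0)
      have h4 : 1 ≤ Real.exp (a * s) := Real.one_le_exp (mul_nonneg ha.le hs.1)
      have h5 : (K : ℝ) * (Real.exp (a * s) * ‖v s‖) ≤ K * (Real.exp (a * s) * ‖v‖) := by
        gcongr; exact v.norm_coe_le_norm s
      nlinarith [norm_nonneg (F 0)]
    have h6 : ‖g τ‖ ≤ b * Real.exp (a * τ) := (hgb τ hτ0).trans (by
      gcongr; nlinarith [K.coe_nonneg])
    calc ‖Ψ v t‖ = Real.exp (-(a * τ)) * ‖g τ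
          + ∫ s in (0 : ℝ)..τ, F (Real.exp (a * s) • v s)‖ := by
          simp only [Ψ, norm_smul, Real.norm_eq_abs, Real.abs_exp, ← hτ]
      _ ≤ Real.exp (-(a * τ)) * (b * Real.exp (a * τ)
          + (‖F 0‖ + K * ‖v‖) / a * Real.exp (a * τ)) := by
          gcongr; exact (norm_add_le _ _).trans (add_le_add h6 h1)
      _ = Real.exp (-(a * τ)) * Real.exp (a * τ) * (b + (‖F 0‖ + K * ‖v‖) / a) := by ring
      _ = _ := by rw [← Real.exp_add]; simp
  let Φ : (ℝ →ᵇ E) → (ℝ →ᵇ E) := fun v =>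
    BoundedContinuousFunction.ofNormedAddCommGroup (Ψ v) (hΨc v) _ (hΨb v)
  have hK : (K : ℝ) / a < 1 := by rw [div_lt_one ha]; linarith
  have hcontr : ContractingWith (K / (K + 1)) Φ := by
    refine ⟨by rw [← NNReal.coe_lt_coe]; simpa using hK, LipschitzWith.of_dist_le_mul fun v v' => ?_⟩
    have hcoe : ((K / (K + 1) : ℝ≥0) : ℝ) = K / a := by simp [ha_def]
    rw [hcoe, BoundedContinuousFunction.dist_le (by positivity)]
    intro t
    set τ := max t 0 with hτ
    have hτ0 : 0 ≤ τ := le_max_right _ _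
    have h1 : ‖∫ s in (0 : ℝ)..τ, (F (Real.exp (a * s) • v s) - F (Real.exp (a * s) • v' s))‖
        ≤ (K * dist v v') / a * Real.exp (a * τ) := by
      refine norm_integral_le_of_norm_le_mul_exp ha (by positivity) hτ0 fun s hs => ?_
      refine (hF.norm_sub_le _ _).trans ?_
      rw [← smul_sub, norm_smul, Real.norm_eq_abs, Real.abs_exp, ← dist_eq_norm]
      have := v.dist_coe_le_dist (g := v') s
      calc (K : ℝ) * (Real.exp (a * s) * dist (v s) (v' s))
          ≤ K * (Real.exp (a * s) * dist v v') := by gcongr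
        _ = _ := by ring
    rw [intervalIntegral.integral_sub ((hcont v).intervalIntegrable _ _)
      ((hcont v').intervalIntegrable _ _)] at h1
    calc dist (Φ v t) (Φ v' t) = ‖Ψ v t - Ψ v' t‖ := by rw [dist_eq_norm]; rfl
      _ = Real.exp (-(a * τ)) * ‖(∫ s in (0 : ℝ)..τ, F (Real.exp (a * s) • v s))
          - ∫ s in (0 : ℝ)..τ, F (Real.exp (a * s) • v' s)‖ := by
          simp only [Ψ, ← smul_sub, norm_smul, Real.norm_eq_abs, Real.abs_exp, ← hτ,
            add_sub_add_left_eq_sub]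
      _ ≤ Real.exp (-(a * τ)) * ((K * dist v v') / a * Real.exp (a * τ)) := by gcongr
      _ = Real.exp (-(a * τ)) * Real.exp (a * τ) * (K / a * dist v v') := by ring
      _ = K / a * dist v v' := by rw [← Real.exp_add]; simp
  obtain ⟨v, hv, -⟩ := hcontr.exists_fixedPoint 0 (edist_ne_top _ _)
  refine ⟨fun t => Real.exp (a * t) • v t, by fun_prop, fun t ht => ?_⟩
  have hvt : v t = Ψ v t := congrArg (fun φ : ℝ →ᵇ E => φ t) hv.symm
  simp only [hvt]
  simp only [Ψ, max_eq_left ht, smul_smul, ← Real.exp_add, add_neg_cancel, Real.exp_zero, one_smul]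

end GlobalExistence

end Platoon

/-! ### Estimates for the spacing maps and the matrices. -/

namespace Platoon

open Set Filter Topology

section Partials

variable {g : ℝ × ℝ → ℝ} {p : ℝ × ℝ}

theorem partial₁_eq_fderiv (hg : DifferentiableAt ℝ g p) : partial₁ g p = fderiv ℝ g p (1, 0) := by
  have h1 : HasDerivAt (fun s : ℝ => (s, p.2)) ((1 : ℝ), (0 : ℝ)) p.1 :=
    (hasDerivAt_id p.1).prodMk (hasDerivAt_const p.1 p.2)
  exact (HasFDerivAt.comp_hasDerivAt (l := g) (l' := fderiv ℝ g p) p.1 hg.hasFDerivAt h1).deriv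

theorem partial₂_eq_fderiv (hg : DifferentiableAt ℝ g p) : partial₂ g p = fderiv ℝ g p (0, 1) := by
  have h1 : HasDerivAt (fun s : ℝ => (p.1, s)) ((0 : ℝ), (1 : ℝ)) p.2 :=
    (hasDerivAt_const p.2 p.1).prodMk (hasDerivAt_id p.2)
  exact (HasFDerivAt.comp_hasDerivAt (l := g) (l' := fderiv ℝ g p) p.2 hg.hasFDerivAt h1).deriv

theorem fderiv_apply_eq_partials (hg : DifferentiableAt ℝ g p) (v : ℝ × ℝ) :
    fderiv ℝ g p v = partial₁ g p * v.1 + partial₂ g p * v.2 := by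
  have hv : v = v.1 • ((1 : ℝ), (0 : ℝ)) + v.2 • ((0 : ℝ), (1 : ℝ)) := by ext <;> simp
  rw [partial₁_eq_fderiv hg, partial₂_eq_fderiv hg]
  conv_lhs => rw [hv, map_add, map_smul, map_smul]
  simp [mul_comm]

end Partials

variable {n : ℕ}

theorem abs_next_sub_le (x y : Fin n → ℝ) (i : Fin n) : |next x i - next y i| ≤ ‖x - y‖ := by
  unfold next
  split_ifs with hi
  · exact norm_le_pi_norm (x - y) _
  · simp

theorem contDiff_next (i : Fin n) : ContDiff ℝ 1 fun x : Fin n → ℝ => next x i := by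
  unfold next
  split_ifs with hi
  · fun_prop
  · fun_prop

namespace Admissible

variable {d : Fin n → ℝ × ℝ → ℝ} {e : Fin n → ℝ} {η₁ c : ℝ}

theorem differentiable (hd : Admissible d e η₁ c) (i : Fin n) : Differentiable ℝ (d i) :=
  (hd.contDiff i).differentiable one_ne_zero

theorem partial₂_nonpos (hd : Admissible d e η₁ c) (i : Fin n) (p : ℝ × ℝ) :
    partial₂ (d i) p ≤ 0 := by
  by_cases hi : (i : ℕ) + 1 < n
  · exact (hd.neg i hi p).le
  · have h1 : (fun s => d i (p.1, s)) = fun _ => d i (p.1, 0) :=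
      funext fun s => hd.last i (by omega) _ _ _
    rw [partial₂, h1, deriv_const]

theorem norm_fderiv_le (hd : Admissible d e η₁ c) (i : Fin n) (p : ℝ × ℝ) :
    ‖fderiv ℝ (d i) p‖ ≤ 2 * c := by
  have h1 := (le_max_left _ _).trans (hd.bound i p)
  have h2 := (le_max_right _ _).trans (hd.bound i p)
  have hc : 0 ≤ c := (abs_nonneg _).trans h1
  refine ContinuousLinearMap.opNorm_le_bound _ (by positivity) fun v => ?_
  rw [fderiv_apply_eq_partials (hd.differentiable i p), Real.norm_eq_abs]
  have hv1 : |v.1| ≤ ‖v‖ := norm_fst_le v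
  have hv2 : |v.2| ≤ ‖v‖ := norm_snd_le v
  calc |partial₁ (d i) p * v.1 + partial₂ (d i) p * v.2|
      ≤ |partial₁ (d i) p| * |v.1| + |partial₂ (d i) p| * |v.2| := by
        rw [← abs_mul, ← abs_mul]; exact abs_add_le _ _
    _ ≤ c * ‖v‖ + c * ‖v‖ := by gcongr
    _ = _ := by ring

theorem abs_sub_le (hd : Admissible d e η₁ c) (i : Fin n) (p q : ℝ × ℝ) :
    |d i p - d i q| ≤ 2 * c * ‖p - q‖ :=
  convex_univ.norm_image_sub_le_of_norm_fderiv_le (fun z _ => hd.differentiable i z)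
    (fun z _ => hd.norm_fderiv_le i z) (mem_univ q) (mem_univ p)

/-- Along the segment from `q` to `p` the derivative is `∂₁ v₁ + ∂₂ v₂` with `v = p - q`. Since `∂₂
≤ 0` and `v₂ ≤ v₁`, it is at least `(∂₁ + ∂₂) v₁ ≥ η₁ v₁`. -/
theorem mul_sub_le (hd : Admissible d e η₁ c) (i : Fin n) {p q : ℝ × ℝ}
    (hpq : p.2 - q.2 ≤ p.1 - q.1) (h0 : 0 ≤ p.1 - q.1) :
    η₁ * (p.1 - q.1) ≤ d i p - d i q := by
  have hγ : ∀ s : ℝ, HasDerivAt (fun s : ℝ => d i (q + s • (p - q)))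
      (fderiv ℝ (d i) (q + s • (p - q)) (p - q)) s := fun s => by
    have h1 : HasDerivAt (fun s : ℝ => q + s • (p - q)) (p - q) s := by
      simpa using ((hasDerivAt_id s).smul_const (p - q)).const_add q
    exact HasFDerivAt.comp_hasDerivAt (l := d i) s (hd.differentiable i _).hasFDerivAt h1
  have hmv := mul_sub_le_image_sub_of_le_deriv (C := η₁ * (p.1 - q.1))
    (fun s => (hγ s).differentiableAt) (fun s => by
      rw [(hγ s).deriv, fderiv_apply_eq_partials (hd.differentiable i _)]
      have h1 := hd.partial₂_nonpos i (q + s • (p - q))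
      have h2 := hd.sum_ge i (q + s • (p - q))
      rw [Prod.fst_sub, Prod.snd_sub]
      nlinarith) (zero_le_one' ℝ)
  simpa using hmv

theorem abs_dval_sub_le (hd : Admissible d e η₁ c) (x y : Fin n → ℝ) (i : Fin n) :
    |dval d x i - dval d y i| ≤ 2 * c * ‖x - y‖ := by
  have hc : 0 ≤ c := (abs_nonneg _).trans ((le_max_left _ _).trans (hd.bound i 0))
  refine (hd.abs_sub_le i _ _).trans ?_
  gcongr
  exact max_le (norm_le_pi_norm (x - y) i) (abs_next_sub_le x y i)

/-- The restoring force on a spacing error that dominates its successor's. For the last index both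
`next` values are `0`, so `hx` reduces to `h0`. -/
theorem mul_sub_le_dval (hd : Admissible d e η₁ c) (x : Fin n → ℝ) (i : Fin n)
    (hx : next x i - next e i ≤ x i - e i) (h0 : 0 ≤ x i - e i) :
    η₁ * (x i - e i) ≤ dval d x i := by
  have := hd.mul_sub_le i (p := (x i, next x i)) (q := (e i, next e i)) hx h0
  have he : d i (e i, next e i) = 0 := hd.equilibrium i
  rwa [he, sub_zero] at this

theorem dval_le_mul_sub (hd : Admissible d e η₁ c) (x : Fin n → ℝ) (i : Fin n)
    (hx : x i - e i ≤ next x i - next e i) (h0 : x i - e i ≤ 0) :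
    dval d x i ≤ η₁ * (x i - e i) := by
  have := hd.mul_sub_le i (q := (x i, next x i)) (p := (e i, next e i))
    (by dsimp only; linarith) (by dsimp only; linarith)
  have he : d i (e i, next e i) = 0 := hd.equilibrium i
  rw [he] at this
  unfold dval
  dsimp only at this
  linarith

theorem lipschitzWith_f (hd : Admissible d e η₁ c) (hc : 0 ≤ c) :
    LipschitzWith (2 * c).toNNReal (f d) := by
  refine LipschitzWith.of_dist_le_mul fun x y => ?_
  rw [Real.coe_toNNReal _ (by positivity), dist_eq_norm, dist_eq_norm]
  refine (pi_norm_le_iff_of_nonneg (by positivity)).2 fun i => ?_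
  have := hd.abs_dval_sub_le y x i
  rw [norm_sub_rev y x] at this
  simpa [f, neg_add_eq_sub] using this

theorem lipschitzWith_h (hd : Admissible d e η₁ c) (hc : 0 ≤ c) :
    LipschitzWith (n * (2 * c)).toNNReal (h d) := by
  refine LipschitzWith.of_dist_le_mul fun x y => ?_
  rw [Real.coe_toNNReal _ (by positivity), dist_eq_norm, dist_eq_norm]
  refine (pi_norm_le_iff_of_nonneg (by positivity)).2 fun i => ?_
  rw [Pi.sub_apply, h, h, ← Finset.sum_sub_distrib]
  refine (norm_sum_le _ _).trans ?_
  refine (Finset.sum_le_card_nsmul _ _ _ fun j _ => hd.abs_dval_sub_le x y j).trans ?_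
  rw [nsmul_eq_mul, mul_assoc (n : ℝ)]
  have : (Finset.Iio i).card ≤ n := by
    simp
  gcongr

theorem contDiff_h (hd : Admissible d e η₁ c) : ContDiff ℝ 1 (h d) := by
  refine contDiff_pi.2 fun i => ?_
  refine ContDiff.sum fun j _ => ?_
  exact (hd.contDiff j).comp
    ((by fun_prop : ContDiff ℝ 1 fun x : Fin n → ℝ => x j).prodMk (contDiff_next j))

theorem f_equilibrium (hd : Admissible d e η₁ c) : f d e = 0 :=
  funext fun i => by simp [f, hd.equilibrium i]

end Admissible

theorem mulVec_A_apply (kbar : Fin n → ℝ) {r : ℕ} (hr : 1 ≤ r) (y : Fin n → ℝ) (i : Fin n) :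
    (A kbar r).mulVec y i = -(kbar i * y i)
      + if r ≤ (i : ℕ) then kbar i * y ⟨i - r, (Nat.sub_le _ _).trans_lt i.2⟩ else 0 := by
  have hsplit : ∀ j : Fin n, A kbar r i j * y j = (if i = j then -(kbar i * y j) else 0)
      + if (i : ℕ) = (j : ℕ) + r then kbar i * y j else 0 := fun j => by
    unfold A
    by_cases h1 : i = j
    -- As `r ≥ 1`, the diagonal and the `r`-th subdiagonal never overlap.
    · subst h1
      simp [Nat.one_le_iff_ne_zero.1 hr]
    · simp [h1]
  simp only [Matrix.mulVec, dotProduct, hsplit, Finset.sum_add_distrib, Finset.sum_ite_eq,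
    Finset.mem_univ, if_true]
  congr 1
  split_ifs with hri
  · rw [Finset.sum_eq_single (⟨i - r, (Nat.sub_le _ _).trans_lt i.2⟩ : Fin n)]
    · simp [Nat.sub_add_cancel hri]
    · intro j _ hj
      rw [if_neg]
      intro h2
      exact hj (Fin.ext (by simp [h2]))
    · simp
  · exact Finset.sum_eq_zero fun j _ => if_neg (by omega)

theorem G_eq_A : G n = A (fun _ => 1) 1 := rfl

theorem norm_mulVec_G_le (y : Fin n → ℝ) : ‖(G n).mulVec y‖ ≤ 2 * ‖y‖ := by
  refine (pi_norm_le_iff_of_nonneg (by positivity)).2 fun i => ?_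
  rw [G_eq_A, mulVec_A_apply _ le_rfl, two_mul]
  refine (norm_add_le _ _).trans (add_le_add ?_ ?_)
  · simpa using norm_le_pi_norm y i
  · split_ifs
    · simpa using norm_le_pi_norm y _
    · simp

theorem lipschitzWith_mulVec (M : Matrix (Fin n) (Fin n) ℝ) :
    ∃ K, LipschitzWith K fun y : Fin n → ℝ => M.mulVec y :=
  ⟨_, (LinearMap.toContinuousLinearMap M.mulVecLin).lipschitz⟩

theorem Admissible.norm_slow_le {d : Fin n → ℝ × ℝ → ℝ} {e : Fin n → ℝ} {η₁ c : ℝ}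
    (hd : Admissible d e η₁ c) (hc : 0 ≤ c) (x y : Fin n → ℝ) :
    ‖slow d x y‖ ≤ 2 * c * ‖x - e‖ + 2 * ‖y‖ := by
  refine (norm_add_le _ _).trans (add_le_add ?_ (norm_mulVec_G_le y))
  have := (hd.lipschitzWith_f hc).norm_sub_le x e
  rwa [hd.f_equilibrium, sub_zero, Real.coe_toNNReal _ (by positivity)] at this

theorem Admissible.norm_fderiv_h_slow_le {d : Fin n → ℝ × ℝ → ℝ} {e : Fin n → ℝ} {η₁ c : ℝ}
    (hd : Admissible d e η₁ c) (hc : 0 ≤ c) (x y : Fin n → ℝ) :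
    ‖fderiv ℝ (h d) x (slow d x y)‖ ≤ n * (2 * c) * (2 * c * ‖x - e‖ + 2 * ‖y‖) := by
  have h1 := norm_fderiv_le_of_lipschitz ℝ (hd.lipschitzWith_h hc) (x₀ := x)
  rw [Real.coe_toNNReal _ (by positivity)] at h1
  refine (ContinuousLinearMap.le_opNorm _ _).trans ?_
  gcongr
  exact hd.norm_slow_le hc x y

end Platoon

/-! ### Essentially bounded signals and solvability of the system. -/

namespace Platoon

open Set Filter Topology

section Signals

variable {E : Type*} [NormedAddCommGroup E] {w : ℝ → E}

theorem EssBounded.ae_norm_le (hw : EssBounded w) :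
    ∀ᵐ s, 0 ≤ s → ‖w s‖ ≤ (signalNorm w).toReal := by
  have h1 := (ae_restrict_iff' measurableSet_Ici).1
    (ae_le_eLpNormEssSup (f := w) (μ := volume.restrict (Ici (0 : ℝ))))
  filter_upwards [h1] with s hs h0
  have h2 := hs h0
  rw [← eLpNorm_exponent_top] at h2
  have h3 := ENNReal.toReal_mono hw.2.ne h2
  simpa using! h3

theorem EssBounded.intervalIntegrable_indicator (hw : EssBounded w) (a b : ℝ) :
    IntervalIntegrable ((Ici (0 : ℝ)).indicator w) volume a b :=
  ((((memLp_indicator_iff_restrict measurableSet_Ici).2 hw).locallyIntegrable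
    le_top).integrableOn_isCompact isCompact_uIcc).intervalIntegrable

theorem EssBounded.intervalIntegrable (hw : EssBounded w) {t : ℝ} (ht : 0 ≤ t) :
    IntervalIntegrable w volume 0 t := by
  refine (hw.intervalIntegrable_indicator 0 t).congr ?_
  intro s hs
  rw [uIoc_of_le ht] at hs
  exact indicator_of_mem (s := Ici (0 : ℝ)) hs.1.le w

end Signals

variable {n : ℕ} {d : Fin n → ℝ × ℝ → ℝ} {e kbar : Fin n → ℝ} {η₁ c ε : ℝ} {r : ℕ}
  {w x y : ℝ → Fin n → ℝ}

theorem Admissible.continuous_slow (hd : Admissible d e η₁ c) (hc : 0 ≤ c) :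
    Continuous fun p : (Fin n → ℝ) × (Fin n → ℝ) => slow d p.1 p.2 := by
  obtain ⟨K, hK⟩ := lipschitzWith_mulVec (G n)
  exact ((hd.lipschitzWith_f hc).continuous.comp continuous_fst).add
    (hK.continuous.comp continuous_snd)

theorem Admissible.continuous_fderiv_h_slow (hd : Admissible d e η₁ c) (hc : 0 ≤ c) :
    Continuous fun p : (Fin n → ℝ) × (Fin n → ℝ) => fderiv ℝ (h d) p.1 (slow d p.1 p.2) :=
  ((hd.contDiff_h.continuous_fderiv one_ne_zero).comp continuous_fst).clm_apply
    (hd.continuous_slow hc)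

/-- The derivative of `h` is merely continuous, so the fast equation need not be Lipschitz in `(x,
y)`. For `z = y + h x` this derivative cancels, leaving `ε⁻¹ A (z - h x) + w`. -/
theorem Admissible.exists_isSolution (hd : Admissible d e η₁ c) (hc : 0 ≤ c) (hε : 0 < ε)
    (hw : EssBounded w) (x₀ y₀ : Fin n → ℝ) :
    ∃ x y : ℝ → Fin n → ℝ, IsSolution d kbar r ε w x y ∧ x 0 = x₀ ∧ y 0 = y₀ := by
  set N := (signalNorm w).toReal with hN
  have hN0 : 0 ≤ N := ENNReal.toReal_nonneg
  -- In the coordinates `(x, z)` with `z = y + h x` the vector field is globally Lipschitz.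
  let F : (Fin n → ℝ) × (Fin n → ℝ) → (Fin n → ℝ) × (Fin n → ℝ) := fun p =>
    (slow d p.1 (p.2 - h d p.1), ε⁻¹ • (A kbar r).mulVec (p.2 - h d p.1))
  obtain ⟨K, hF⟩ : ∃ K, LipschitzWith K F := by
    obtain ⟨K₁, h1⟩ := lipschitzWith_mulVec (G n)
    obtain ⟨K₂, h2⟩ := lipschitzWith_mulVec (A kbar r)
    have hy := LipschitzWith.prod_snd.sub ((hd.lipschitzWith_h hc).comp
      (LipschitzWith.prod_fst (α := Fin n → ℝ) (β := Fin n → ℝ)))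
    exact ⟨_, (((hd.lipschitzWith_f hc).comp LipschitzWith.prod_fst).add (h1.comp hy)).prodMk
      ((lipschitzWith_smul ε⁻¹).comp (h2.comp hy))⟩
  -- Nothing is known of `w` at negative times; extension by zero makes its primitive continuous on
  -- all of `ℝ`.
  set w' : ℝ → Fin n → ℝ := (Ici (0 : ℝ)).indicator w with hw'
  have hw'int : ∀ a b : ℝ, IntervalIntegrable w' volume a b := hw.intervalIntegrable_indicator
  have hww' : ∀ s : ℝ, 0 ≤ s → w' s = w s := fun s hs => indicator_of_mem (s := Ici (0 : ℝ)) hs w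
  let g : ℝ → (Fin n → ℝ) × (Fin n → ℝ) := fun t =>
    (x₀, y₀ + h d x₀ + ∫ s in (0 : ℝ)..t, w' s)
  have hg : Continuous g := continuous_const.prodMk
    (continuous_const.add (intervalIntegral.continuous_primitive hw'int 0))
  have hgb : ∀ t, 0 ≤ t → ‖g t‖ ≤ (‖x₀‖ + ‖y₀ + h d x₀‖ + N) * Real.exp t := fun t ht => by
    have hint : ‖∫ s in (0 : ℝ)..t, w' s‖ ≤ N * t := by
      have := intervalIntegral.norm_integral_le_of_norm_le (f := w') (g := fun _ => N) ht
        (by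
          filter_upwards [hw.ae_norm_le] with s hs hmem
          rw [hww' s hmem.1.le]
          exact hs hmem.1.le) (intervalIntegrable_const (μ := volume))
      simpa [mul_comm] using this
    have h1 : 1 ≤ Real.exp t := Real.one_le_exp ht
    have h2 : t ≤ Real.exp t := by linarith [Real.add_one_le_exp t]
    have h3 : N * t ≤ N * Real.exp t := by gcongr
    have h4 : ‖y₀ + h d x₀ + ∫ s in (0 : ℝ)..t, w' s‖ ≤ ‖y₀ + h d x₀‖ + N * t :=
      (norm_add_le _ _).trans (by gcongr)
    refine max_le ?_ (h4.trans ?_)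
    · change ‖x₀‖ ≤ _
      nlinarith [norm_nonneg x₀, norm_nonneg (y₀ + h d x₀)]
    · nlinarith [norm_nonneg x₀, norm_nonneg (y₀ + h d x₀)]
  obtain ⟨u, huc, hu⟩ := exists_eq_add_integral_of_lipschitz hF hg hgb
  set y : ℝ → Fin n → ℝ := fun t => (u t).2 - h d (u t).1 with hy
  have hFu : ∀ t, IntervalIntegrable (fun s => F (u s)) volume 0 t := fun t =>
    (hF.continuous.comp huc).intervalIntegrable _ _
  have hxc : Continuous fun t => (u t).1 := continuous_fst.comp huc
  have hyc : Continuous y :=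
    (continuous_snd.comp huc).sub ((hd.lipschitzWith_h hc).continuous.comp hxc)
  have hsc : Continuous fun s => slow d (u s).1 (y s) :=
    (hd.continuous_slow hc).comp (hxc.prodMk hyc)
  have hDc : Continuous fun s => fderiv ℝ (h d) (u s).1 (slow d (u s).1 (y s)) :=
    (hd.continuous_fderiv_h_slow hc).comp (hxc.prodMk hyc)
  have hAc : Continuous fun s => ε⁻¹ • (A kbar r).mulVec (y s) := by
    obtain ⟨K₂, h2⟩ := lipschitzWith_mulVec (A kbar r)
    exact (h2.continuous.comp hyc).const_smul ε⁻¹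
  have hx : ∀ t, 0 ≤ t → (u t).1 = x₀ + ∫ s in (0 : ℝ)..t, slow d (u s).1 (y s) := fun t ht => by
    have h1 := (ContinuousLinearMap.fst ℝ (Fin n → ℝ) (Fin n → ℝ)).intervalIntegral_comp_comm
      (hFu t)
    have h2 := congrArg Prod.fst (hu t ht)
    rw [Prod.fst_add] at h2
    rw [h2]
    congr 1
    exact h1.symm
  have hz : ∀ t, 0 ≤ t → (u t).2 = y₀ + h d x₀ + (∫ s in (0 : ℝ)..t, w' s)
      + ∫ s in (0 : ℝ)..t, ε⁻¹ • (A kbar r).mulVec (y s) := fun t ht => by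
    have h1 := (ContinuousLinearMap.snd ℝ (Fin n → ℝ) (Fin n → ℝ)).intervalIntegral_comp_comm
      (hFu t)
    have h2 := congrArg Prod.snd (hu t ht)
    rw [Prod.snd_add] at h2
    rw [h2]
    congr 1
    exact h1.symm
  have hx0 : (u 0).1 = x₀ := by simpa using hx 0 le_rfl
  have hy0 : y 0 = y₀ := by
    simp only [hy]
    rw [hx0, hz 0 le_rfl]
    simp
  -- The slow field is continuous along the solution, so `x` is differentiable at positive times and
  -- the chain rule restores the derivative term lost in passing to `z`.
  have hh : ∀ t, 0 ≤ t → h d (u t).1 - h d x₀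
      = ∫ s in (0 : ℝ)..t, fderiv ℝ (h d) (u s).1 (slow d (u s).1 (y s)) := fun t ht => by
    symm
    rw [← hx0]
    refine intervalIntegral.integral_eq_sub_of_hasDeriv_right_of_le ht
      ((hd.lipschitzWith_h hc).continuous.comp hxc).continuousOn (fun s hs => ?_)
      (hDc.intervalIntegrable _ _)
    have hX : HasDerivAt (fun t => (u t).1) (slow d (u s).1 (y s)) s := by
      have h1 : HasDerivAt (fun t => x₀ + ∫ s in (0 : ℝ)..t, slow d (u s).1 (y s))
          (slow d (u s).1 (y s)) s :=
        (hsc.integral_hasStrictDerivAt 0 s).hasDerivAt.const_add x₀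
      refine h1.congr_of_eventuallyEq ?_
      filter_upwards [lt_mem_nhds hs.1] with τ hτ using hx τ hτ.le
    exact (HasFDerivAt.comp_hasDerivAt (l := h d) s
      ((hd.contDiff_h.differentiable one_ne_zero) _).hasFDerivAt hX).hasDerivWithinAt
  refine ⟨fun t => (u t).1, y, ⟨hxc.continuousOn, hyc.continuousOn, fun t ht => ?_,
    fun t ht => ?_⟩, hx0, hy0⟩
  · rw [hx0]
    exact hx t ht
  · have hcongr : ∫ s in (0 : ℝ)..t, ε⁻¹ • fast d kbar r ε (u s).1 (y s) (w s)
        = ∫ s in (0 : ℝ)..t, (ε⁻¹ • (A kbar r).mulVec (y s)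
          - fderiv ℝ (h d) (u s).1 (slow d (u s).1 (y s)) + w' s) := by
      refine intervalIntegral.integral_congr fun s hs => ?_
      rw [uIcc_of_le ht] at hs
      simp only [fast, smul_add, smul_sub, smul_smul, inv_mul_cancel₀ hε.ne', one_smul,
        hww' s hs.1]
    have hadd := intervalIntegral.integral_add ((hAc.sub hDc).intervalIntegrable 0 t) (hw'int 0 t)
    simp only [Pi.sub_apply] at hadd
    rw [hcongr, hadd,
      intervalIntegral.integral_sub (hAc.intervalIntegrable _ _) (hDc.intervalIntegrable _ _),
      ← hh t ht, hy0]
    simp only [hy]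
    rw [hz t ht]
    abel

theorem IsSolution.intervalIntegrable_slow (hs : IsSolution d kbar r ε w x y)
    (hd : Admissible d e η₁ c) (hc : 0 ≤ c) {T : ℝ} (hT : 0 ≤ T) :
    IntervalIntegrable (fun s => slow d (x s) (y s)) volume 0 T := by
  refine ContinuousOn.intervalIntegrable ?_
  rw [uIcc_of_le hT]
  exact (hd.continuous_slow hc).comp_continuousOn
    ((hs.cont_x.prodMk hs.cont_y).mono Icc_subset_Ici_self)

theorem IsSolution.intervalIntegrable_fast (hs : IsSolution d kbar r ε w x y)
    (hd : Admissible d e η₁ c) (hc : 0 ≤ c) (hw : EssBounded w) {T : ℝ} (hT : 0 ≤ T) :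
    IntervalIntegrable (fun s => ε⁻¹ • fast d kbar r ε (x s) (y s) (w s)) volume 0 T := by
  have h1 : ContinuousOn (fun s => (A kbar r).mulVec (y s)
      - ε • fderiv ℝ (h d) (x s) (slow d (x s) (y s))) (uIcc 0 T) := by
    rw [uIcc_of_le hT]
    obtain ⟨K₂, h2⟩ := lipschitzWith_mulVec (A kbar r)
    refine (h2.continuous.comp_continuousOn (hs.cont_y.mono Icc_subset_Ici_self)).sub
      (ContinuousOn.const_smul ?_ ε)
    exact (hd.continuous_fderiv_h_slow hc).comp_continuousOn
      ((hs.cont_x.prodMk hs.cont_y).mono Icc_subset_Ici_self)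
  exact (h1.intervalIntegrable.add ((hw.intervalIntegrable hT).smul ε)).smul ε⁻¹

theorem eq_add_integral_apply {u g : ℝ → Fin n → ℝ}
    (hu : ∀ t, 0 ≤ t → u t = u 0 + ∫ s in (0 : ℝ)..t, g s)
    (hg : ∀ t, 0 ≤ t → IntervalIntegrable g volume 0 t) (i : Fin n) {t : ℝ} (ht : 0 ≤ t) :
    u t i = u 0 i + ∫ s in (0 : ℝ)..t, g s i := by
  have h1 := (ContinuousLinearMap.proj (R := ℝ) (φ := fun _ : Fin n => ℝ) i).intervalIntegral_comp_comm
      (hg t ht)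
  rw [hu t ht, Pi.add_apply]
  congr 1
  exact h1.symm

theorem intervalIntegrable_apply {g : ℝ → Fin n → ℝ} {t : ℝ}
    (hg : IntervalIntegrable g volume 0 t) (i : Fin n) :
    IntervalIntegrable (fun s => g s i) volume 0 t :=
  ⟨hg.1.eval i, hg.2.eval i⟩

end Platoon

/-! ### Barriers for the slow and fast variables. -/

namespace Platoon

open Set Filter Topology

variable {n : ℕ} {d : Fin n → ℝ × ℝ → ℝ} {e kbar : Fin n → ℝ} {η₁ c ε : ℝ} {r : ℕ}
  {w x y : ℝ → Fin n → ℝ}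

theorem hasDerivAt_neg_mul (a t : ℝ) : HasDerivAt (fun t => -(a * t)) (-a) t := by
  simpa only [mul_one] using! ((hasDerivAt_id t).const_mul a).neg

/-- The barrier starts above `2 * β / η₁`, so the restoring force beats the constant part `2 * β` of
the bound on `G y`; its slope `2 * b * exp (-(a * t))` pays for the decaying part and has total
integral at most `2 * b / a`. -/
theorem norm_sub_le_add_integral_exp_bound (hs : IsSolution d kbar r ε w x y)
    (hd : Admissible d e η₁ c) (hc : 0 ≤ c) (hη : 0 < η₁) {T a b β : ℝ} (ha : 0 < a)
    (hb : 0 ≤ b) (hβ : 0 ≤ β)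
    (hy : ∀ t ∈ Icc 0 T, ‖y t‖ ≤ b * Real.exp (-(a * t)) + β) :
    ∀ t ∈ Icc 0 T, ‖x t - e‖ ≤ ‖x 0 - e‖ + 2 * β / η₁ + 2 * b / a := by
  set B : ℝ → ℝ := fun t =>
    ‖x 0 - e‖ + 2 * β / η₁ + 2 * b / a * (1 - Real.exp (-(a * t))) with hBdef
  set B' : ℝ → ℝ := fun t => 2 * b * Real.exp (-(a * t)) with hB'def
  have hB : ∀ t, HasDerivAt B (B' t) t := fun t => by
    have h1 := hasDerivAt_neg_mul a t
    have h2 := ((h1.exp.const_sub 1).const_mul (2 * b / a)).const_add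
      (‖x 0 - e‖ + 2 * β / η₁)
    refine h2.congr_deriv ?_
    calc 2 * b / a * -(Real.exp (-(a * t)) * -a) = 2 * b / a * a * Real.exp (-(a * t)) := by ring
      _ = B' t := by rw [div_mul_cancel₀ _ ha.ne']
  have hB' : Continuous B' := by fun_prop
  have hBge : ∀ t, 0 ≤ t → 2 * β / η₁ ≤ B t := fun t ht => by
    have h1 : Real.exp (-(a * t)) ≤ 1 := Real.exp_le_one_iff.2 (by nlinarith)
    have h2 : 0 ≤ 2 * b / a * (1 - Real.exp (-(a * t))) :=
      mul_nonneg (by positivity) (by linarith)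
    simp only [hBdef]
    linarith [norm_nonneg (x 0 - e)]
  have hB0 : ∀ t, 0 ≤ t → 0 ≤ B t := fun t ht =>
    le_trans (by positivity) (hBge t ht)
  have hG : ∀ t ∈ Icc 0 T, ∀ i, |(G n).mulVec (y t) i| ≤ B' t + 2 * β := fun t ht i => by
    have h1 := (norm_le_pi_norm ((G n).mulVec (y t)) i).trans (norm_mulVec_G_le (y t))
    rw [Real.norm_eq_abs] at h1
    simp only [hB'def]
    linarith [hy t ht]
  have hηB : ∀ t, 0 ≤ t → 2 * β ≤ η₁ * B t := fun t ht => by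
    have := hBge t ht
    rwa [div_le_iff₀ hη, mul_comm (B t)] at this
  -- Downward induction on the index, from the last vehicle to the first.
  have key : ∀ k : ℕ, ∀ i : Fin n, n - (i : ℕ) = k → ∀ t ∈ Icc 0 T, |x t i - e i| ≤ B t := by
    intro k
    induction k with
    | zero => intro i hi; omega
    | succ k ih =>
      intro i hi
      have hnext : ∀ t ∈ Icc 0 T, |next (x t) i - next e i| ≤ B t := fun t ht => by
        unfold next
        split_ifs with hin
        · exact ih ⟨i + 1, hin⟩ (by simp only; omega) t ht
        -- For the last index both `next` values are the default `0`, which starts the downward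
        -- induction.
        · simpa using hB0 t ht.1
      intro t ht
      have hT : 0 ≤ T := ht.1.trans ht.2
      refine abs_le_barrier_of_integral (u := fun s => x s i - e i)
        (g := fun s => slow d (x s) (y s) i) (fun t ht => ?_)
        (intervalIntegrable_apply (hs.intervalIntegrable_slow hd hc hT) i) hB hB' ?_ ?_ ?_ t ht
      · rw [eq_add_integral_apply hs.eq_x (fun t ht => hs.intervalIntegrable_slow hd hc ht) i ht.1]
        ring
      · have h1 : |x 0 i - e i| ≤ ‖x 0 - e‖ := norm_le_pi_norm (x 0 - e) i
        have h2 : 0 ≤ 2 * β / η₁ := by positivity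
        simp only [hBdef, mul_zero, neg_zero, Real.exp_zero, sub_self]
        linarith
      · refine Eventually.of_forall fun s hsT hlt => ?_
        have h1 := (abs_le.1 (hnext s hsT)).2
        have h2 := hd.mul_sub_le_dval (x s) i (by linarith) (by linarith [hB0 s hsT.1])
        have h3 := (abs_le.1 (hG s hsT i)).2
        have h4 : η₁ * B s ≤ η₁ * (x s i - e i) := by gcongr
        have h5 : slow d (x s) (y s) i = -dval d (x s) i + (G n).mulVec (y s) i := rfl
        linarith [hηB s hsT.1]
      · refine Eventually.of_forall fun s hsT hlt => ?_
        have h1 := (abs_le.1 (hnext s hsT)).1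
        have h2 := hd.dval_le_mul_sub (x s) i (by linarith) (by linarith [hB0 s hsT.1])
        have h3 := (abs_le.1 (hG s hsT i)).1
        have h4 : η₁ * (x s i - e i) ≤ η₁ * (-B s) := by gcongr
        have h5 : slow d (x s) (y s) i = -dval d (x s) i + (G n).mulVec (y s) i := rfl
        linarith [hηB s hsT.1]
  intro t ht
  have hBle : B t ≤ ‖x 0 - e‖ + 2 * β / η₁ + 2 * b / a := by
    have h1 : 2 * b / a * (1 - Real.exp (-(a * t))) ≤ 2 * b / a * 1 := by
      gcongr; linarith [Real.exp_pos (-(a * t))]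
    simp only [hBdef]
    linarith
  exact (pi_norm_le_iff_of_nonneg ((hB0 t ht.1).trans hBle)).2 fun i =>
    (key _ i rfl t ht).trans hBle

/-- Strong induction on the index with barrier `2 ^ m * b t`. Half of the damping is left after the
coupling, hence the rate `k / (2 * ε)`; the residual `ε * (2 * P / k)` is where this remaining
damping balances `P`. -/
theorem norm_fast_variable_le (hs : IsSolution d kbar r ε w x y)
    (hd : Admissible d e η₁ c) (hc : 0 ≤ c) (hw : EssBounded w) (hε : 0 < ε) (hr : 1 ≤ r)
    {k : ℝ} (hk : 0 < k) (hkbar : ∀ i, k ≤ kbar i) {T P : ℝ} (hP0 : 0 ≤ P)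
    (hP : ∀ᵐ s, s ∈ Icc 0 T → ‖w s - fderiv ℝ (h d) (x s) (slow d (x s) (y s))‖ ≤ P) :
    ∀ t ∈ Icc 0 T, ‖y t‖ ≤ 2 ^ n * ‖y 0‖ * Real.exp (-(k / (2 * ε) * t))
      + 2 ^ n * (ε * (2 * P / k)) := by
  set a := k / (2 * ε) with ha_def
  have haε : ε * a = k / 2 := by rw [ha_def]; field_simp
  set b : ℝ → ℝ := fun t => ‖y 0‖ * Real.exp (-(a * t)) + ε * (2 * P / k) with hbdef
  have hb0 : ∀ t, 0 ≤ b t := fun t => by positivity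
  have hB : ∀ m : ℕ, ∀ t, HasDerivAt (fun t => 2 ^ m * b t)
      (2 ^ m * (‖y 0‖ * (Real.exp (-(a * t)) * -a))) t := fun m t => by
    have h1 := hasDerivAt_neg_mul a t
    exact ((h1.exp.const_mul ‖y 0‖).add_const _).const_mul _
  have hP' : ∀ᵐ s, s ∈ Icc 0 T → ∀ i,
      |(w s - fderiv ℝ (h d) (x s) (slow d (x s) (y s))) i| ≤ P := by
    filter_upwards [hP] with s hs hmem i
    exact (norm_le_pi_norm _ i).trans (hs hmem)
  have hfast : ∀ s i, (ε⁻¹ • fast d kbar r ε (x s) (y s) (w s)) i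
      = ε⁻¹ * (A kbar r).mulVec (y s) i
        + (w s - fderiv ℝ (h d) (x s) (slow d (x s) (y s))) i := fun s i => by
    simp only [fast, Pi.smul_apply, Pi.add_apply, Pi.sub_apply, smul_eq_mul]
    field_simp
    ring
  -- The slope of the barrier dominates the vector field on the barrier.
  have hslope : ∀ (m : ℕ) (κ t v : ℝ), k ≤ κ → 2 ^ m * b t ≤ v →
      ε⁻¹ * (-(κ * v) + κ * (2 ^ m * b t / 2)) + P
        ≤ 2 ^ m * (‖y 0‖ * (Real.exp (-(a * t)) * -a)) := by
    intro m κ t v hκ hv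
    have hm : (1 : ℝ) ≤ 2 ^ m := one_le_pow₀ one_le_two
    have hκ0 : 0 ≤ κ := hk.le.trans hκ
    have h1 : κ * (2 ^ m * b t) ≤ κ * v := by gcongr
    have h2 : k * (2 ^ m * b t) ≤ κ * (2 ^ m * b t) := by
      have := hb0 t
      gcongr
    have h3 : -(κ * v) + κ * (2 ^ m * b t / 2) ≤ -(k / 2) * (2 ^ m * b t) := by linarith
    have h4 : ε⁻¹ * (-(κ * v) + κ * (2 ^ m * b t / 2)) ≤ ε⁻¹ * (-(k / 2) * (2 ^ m * b t)) := by
      gcongr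
    have h5 : ε⁻¹ * (-(k / 2) * (2 ^ m * b t))
        = 2 ^ m * (‖y 0‖ * (Real.exp (-(a * t)) * -a)) - 2 ^ m * P := by
      simp only [hbdef, ha_def]
      field_simp
      ring
    nlinarith
  have key : ∀ m : ℕ, ∀ i : Fin n, (i : ℕ) = m → ∀ t ∈ Icc 0 T, |y t i| ≤ 2 ^ m * b t := by
    intro m
    induction m using Nat.strong_induction_on with
    | _ m ih =>
      intro i him t ht
      have hT : 0 ≤ T := ht.1.trans ht.2
      have hκ0 : 0 ≤ kbar i := hk.le.trans (hkbar i)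
      have hprev : ∀ s ∈ Icc 0 T, |(A kbar r).mulVec (y s) i + kbar i * y s i|
          ≤ kbar i * (2 ^ m * b s / 2) := fun s hsT => by
        rw [mulVec_A_apply _ hr]
        have hnn : 0 ≤ 2 ^ m * b s / 2 := by have := hb0 s; positivity
        split_ifs with hri
        · rw [show ∀ p q : ℝ, -p + q + p = q from fun p q => by ring, abs_mul, abs_of_nonneg hκ0]
          gcongr
          refine (ih (m - r) (by omega) _ (by simp [him]) s hsT).trans ?_
          -- Since `r ≥ 1`, the weight of the predecessor is at most half the current one, uniformly
          -- in `r`.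
          have h1 : (2 : ℝ) ^ (m - r) * 2 ≤ 2 ^ m := by
            rw [← pow_succ]
            exact pow_le_pow_right₀ one_le_two (by omega)
          have := mul_le_mul_of_nonneg_right h1 (hb0 s)
          linarith
        · rw [add_zero, neg_add_cancel, abs_zero]
          positivity
      refine abs_le_barrier_of_integral (u := fun s => y s i)
        (g := fun s => (ε⁻¹ • fast d kbar r ε (x s) (y s) (w s)) i)
        (fun t ht => eq_add_integral_apply hs.eq_y
          (fun t ht => hs.intervalIntegrable_fast hd hc hw ht) i ht.1)
        (intervalIntegrable_apply (hs.intervalIntegrable_fast hd hc hw hT) i) (hB m)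
        (by fun_prop) ?_ ?_ ?_ t ht
      · have h1 : |y 0 i| ≤ ‖y 0‖ := norm_le_pi_norm (y 0) i
        have h2 : ‖y 0‖ ≤ b 0 := by
          have : 0 ≤ ε * (2 * P / k) := by positivity
          simp only [hbdef, mul_zero, neg_zero, Real.exp_zero, mul_one]
          linarith
        have hm : (1 : ℝ) ≤ 2 ^ m := one_le_pow₀ one_le_two
        nlinarith [hb0 0]
      · filter_upwards [hP'] with s hsP hsT hlt
        have h1 := (abs_le.1 (hsP hsT i)).2
        have h2 := (abs_le.1 (hprev s hsT)).2
        have h3 := hslope m (kbar i) s (y s i) (hkbar i) hlt.le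
        have h4 : ε⁻¹ * (A kbar r).mulVec (y s) i
            ≤ ε⁻¹ * (-(kbar i * y s i) + kbar i * (2 ^ m * b s / 2)) := by
          gcongr; linarith
        rw [hfast]
        linarith
      · filter_upwards [hP'] with s hsP hsT hlt
        have h1 := (abs_le.1 (hsP hsT i)).1
        have h2 := (abs_le.1 (hprev s hsT)).1
        have h3 := hslope m (kbar i) s (-y s i) (hkbar i) (by linarith)
        have h4 : ε⁻¹ * -(A kbar r).mulVec (y s) i
            ≤ ε⁻¹ * (-(kbar i * -y s i) + kbar i * (2 ^ m * b s / 2)) := by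
          gcongr; linarith
        rw [hfast]
        linarith
  intro t ht
  have hbt : 2 ^ n * b t = 2 ^ n * ‖y 0‖ * Real.exp (-(a * t)) + 2 ^ n * (ε * (2 * P / k)) := by
    simp only [hbdef]; ring
  rw [← hbt]
  refine (pi_norm_le_iff_of_nonneg (mul_nonneg (by positivity) (hb0 t))).2 fun i => ?_
  refine (key i i rfl t ht).trans ?_
  have := hb0 t
  gcongr
  · exact one_le_two
  · exact i.2.le

/-- Uniform bounds, by continuation: the fast variable stays within its initial layer and the
maximal spacing error exceeds its initial value by a term of order `ε`. -/
theorem IsSolution.norm_spacing_error_le (hs : IsSolution d kbar r ε w x y)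
    (hd : Admissible d e η₁ c) (hc : 0 ≤ c) (hη : 0 < η₁) (hw : EssBounded w) (hε : 0 < ε)
    (hr : 1 ≤ r) {k : ℝ} (hk : 0 < k) (hkbar : ∀ i, k ≤ kbar i) {R D : ℝ}
    (hx0 : ‖x 0 - e‖ ≤ R) (hy0 : ‖y 0‖ ≤ R)
    (hD : D = n * (2 * c) * (2 * c * (R + 1) + 2 * (2 ^ n * R + 1)))
    (hεy : 2 ^ n * (ε * (2 * (D + (signalNorm w).toReal) / k)) < 1)
    (hεx : ε * (2 ^ (n + 2) * (D + (signalNorm w).toReal) / (k * η₁) + 2 ^ (n + 2) * R / k) < 1) :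
    ∀ t, 0 ≤ t → ‖x t - e‖ ≤ ‖x 0 - e‖
      + ε * (2 ^ (n + 2) * (D + (signalNorm w).toReal) / (k * η₁) + 2 ^ (n + 2) * R / k) := by
  set N := (signalNorm w).toReal with hN
  have hN0 : 0 ≤ N := ENNReal.toReal_nonneg
  have hR : 0 ≤ R := (norm_nonneg _).trans hy0
  have hD0 : 0 ≤ D := by rw [hD]; positivity
  -- On this tube `D` bounds the derivative of `h` along the flow, so the forcing is at most `D +
  -- N`. By `hεy` and `hεx` the resulting bounds lie strictly inside the tube, as continuation
  -- requires.
  have step : ∀ T, 0 ≤ T →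
      (∀ t ∈ Icc 0 T, ‖x t - e‖ ≤ R + 1 ∧ ‖y t‖ ≤ 2 ^ n * R + 1) →
      ‖y T‖ ≤ 2 ^ n * R + 2 ^ n * (ε * (2 * (D + N) / k)) ∧ ‖x T - e‖ ≤ ‖x 0 - e‖
        + ε * (2 ^ (n + 2) * (D + N) / (k * η₁) + 2 ^ (n + 2) * R / k) := by
    intro T hT hbd
    have hmem : T ∈ Icc 0 T := ⟨hT, le_rfl⟩
    have hy := norm_fast_variable_le hs hd hc hw hε hr hk hkbar (T := T) (P := D + N)
      (by positivity) (by
        filter_upwards [hw.ae_norm_le] with s hsw hsT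
        have h1 := hd.norm_fderiv_h_slow_le hc (x s) (y s)
        have h2 : n * (2 * c) * (2 * c * ‖x s - e‖ + 2 * ‖y s‖) ≤ D := by
          rw [hD]
          gcongr
          · exact (hbd s hsT).1
          · exact (hbd s hsT).2
        refine (norm_sub_le _ _).trans ?_
        linarith [hsw hsT.1])
    have ha : 0 < k / (2 * ε) := by positivity
    have hx := norm_sub_le_add_integral_exp_bound hs hd hc hη ha (by positivity) (by positivity) hy
      T hmem
    refine ⟨(hy T hmem).trans ?_, hx.trans ?_⟩
    · have h1 : Real.exp (-(k / (2 * ε) * T)) ≤ 1 :=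
        Real.exp_le_one_iff.2 (neg_nonpos.2 (mul_nonneg ha.le hT))
      have h2 : 2 ^ n * ‖y 0‖ * Real.exp (-(k / (2 * ε) * T)) ≤ 2 ^ n * R * 1 := by gcongr
      linarith
    · have h1 : 2 * (2 ^ n * (ε * (2 * (D + N) / k))) / η₁
          = ε * (2 ^ (n + 2) * (D + N) / (k * η₁)) := by
        rw [pow_add]; field_simp
      have h2 : 2 * (2 ^ n * ‖y 0‖) / (k / (2 * ε)) = ε * (2 ^ (n + 2) * ‖y 0‖ / k) := by
        rw [pow_add]; field_simp
      have h3 : ε * (2 ^ (n + 2) * ‖y 0‖ / k) ≤ ε * (2 ^ (n + 2) * R / k) := by gcongr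
      rw [h1, h2]
      linarith
  have hq := nonpos_of_forall_nonpos_imp_neg
    (q := fun t => max (‖x t - e‖ - (R + 1)) (‖y t‖ - (2 ^ n * R + 1)))
    (((hs.cont_x.sub continuousOn_const).norm.sub continuousOn_const).sup
      (hs.cont_y.norm.sub continuousOn_const))
    (by
      have : R ≤ 2 ^ n * R := le_mul_of_one_le_left hR (one_le_pow₀ one_le_two)
      exact max_le (by linarith) (by linarith))
    (fun T hT hbd => by
      obtain ⟨h1, h2⟩ := step T hT fun t ht => by
        have := max_le_iff.1 (hbd t ht)
        exact ⟨by linarith [this.1], by linarith [this.2]⟩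
      exact max_lt (by linarith) (by linarith))
  intro T hT
  refine (step T hT fun t ht => ?_).2
  have := max_le_iff.1 (hq t ht.1)
  exact ⟨by linarith [this.1], by linarith [this.2]⟩

theorem exists_pos_le_of_forall_pos (hk : ∀ i, 0 < kbar i) : ∃ k : ℝ, 0 < k ∧ ∀ i, k ≤ kbar i := by
  rcases isEmpty_or_nonempty (Fin n) with hn | hn
  · exact ⟨1, one_pos, fun i => (hn.false i).elim⟩
  · obtain ⟨i, hi⟩ := Finite.exists_min kbar
    exact ⟨kbar i, hk i, hi⟩

theorem one_le_sqrt_ceil_div (hr : 1 ≤ r) (hrn : r ≤ n) : 1 ≤ √(⌈(n : ℝ) / (r : ℝ)⌉₊ : ℝ) := by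
  rw [Real.one_le_sqrt, Nat.one_le_cast, Nat.one_le_ceil_iff]
  have h1 : (0 : ℝ) < r := by exact_mod_cast hr
  have h2 : (0 : ℝ) < n := by exact_mod_cast hr.trans hrn
  positivity

end Platoon

/-! ### Choice of constants and conclusion. -/

theorem corollary1 (n : ℕ) (d : Fin n → ℝ × ℝ → ℝ) (e kbar : Fin n → ℝ) (η₁ c : ℝ)
    (hη₁ : 0 < η₁) (hc : 0 < c) (hd : Platoon.Admissible d e η₁ c) :
    ∃ C : ℝ, 0 < C ∧
      ∀ r : ℕ, 1 ≤ r → r ≤ n →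
      (∃ εbar : ℝ, 0 < εbar ∧ ∀ i, -kbar i + 2 * εbar * c * ((r : ℝ) - 1) < 0) →
      ∀ σ : ℝ, 0 < σ →
      ∀ w : ℝ → Fin n → ℝ, Platoon.EssBounded w →
      ∀ Ω : Set ((Fin n → ℝ) × (Fin n → ℝ)), Bornology.IsBounded Ω →
      ∃ εstar : ℝ, 0 < εstar ∧
        ∀ ε : ℝ, 0 < ε → ε ≤ εstar →
        ∀ x₀ y₀ : Fin n → ℝ, (x₀, y₀) ∈ Ω →
          (∃ x y : ℝ → Fin n → ℝ, Platoon.IsSolution d kbar r ε w x y ∧ x 0 = x₀ ∧ y 0 = y₀) ∧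
          ∀ x y : ℝ → Fin n → ℝ, Platoon.IsSolution d kbar r ε w x y → x 0 = x₀ → y 0 = y₀ →
            ∀ i : Fin n,
              Platoon.signalNorm (fun t => x t i - e i) ≤
                ENNReal.ofReal (‖x₀ - e‖
                  + ε * C * √(⌈(n : ℝ) / (r : ℝ)⌉₊ : ℝ) * (Platoon.signalNorm w).toReal
                  + σ) := by
  by_cases hkpos : ∀ i, 0 < kbar i
  swap
  -- A nonpositive gain contradicts the `εbar` condition for every `r ≥ 1`, so any constant works.
  · refine ⟨1, one_pos, fun r hr _ ⟨εbar, hεbar, hA⟩ => (hkpos fun i => ?_).elim⟩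
    have h1 : (1 : ℝ) ≤ r := by exact_mod_cast hr
    have h2 : 0 ≤ 2 * εbar * c * ((r : ℝ) - 1) := mul_nonneg (by positivity) (by linarith)
    linarith [hA i]
  obtain ⟨k, hk, hkbar⟩ := Platoon.exists_pos_le_of_forall_pos hkpos
  -- The coefficient of `ε * N` in `2 * β / η₁`, where `β = 2 ^ n * (ε * (2 * (D + N) / k))`; it
  -- does not involve `r`.
  refine ⟨2 ^ (n + 2) / (k * η₁), by positivity, fun r hr hrn _ σ hσ w hw Ω hΩ => ?_⟩
  obtain ⟨S, hS, hΩS⟩ := hΩ.exists_pos_norm_le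
  set N := (Platoon.signalNorm w).toReal with hN
  have hN0 : 0 ≤ N := ENNReal.toReal_nonneg
  set R := S + ‖e‖ with hR
  have hR0 : 0 ≤ R := by positivity
  set D : ℝ := n * (2 * c) * (2 * c * (R + 1) + 2 * (2 ^ n * R + 1)) with hD
  have hD0 : 0 ≤ D := by positivity
  -- `Q` collects all the `O(ε)` coefficients: `ε * Q < 1` runs the continuation and `ε * Q < σ`
  -- absorbs the terms without `N`.
  set Q : ℝ := 2 ^ (n + 2) * (D + N) / (k * η₁) + 2 ^ (n + 2) * R / k + 2 ^ n * (2 * (D + N) / k)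
    with hQ
  have hQ0 : 0 ≤ Q := by positivity
  refine ⟨min 1 σ / (Q + 1), by positivity, fun ε hε hεle x₀ y₀ hmem =>
    ⟨hd.exists_isSolution hc.le hε hw x₀ y₀, fun x y hs hx0 hy0 i => ?_⟩⟩
  have hεQ : ε * Q < min 1 σ := by
    rw [le_div_iff₀ (by positivity)] at hεle
    linarith
  have hnorm := hΩS _ hmem
  have hx₀ : ‖x₀‖ ≤ S := (norm_fst_le (x₀, y₀)).trans hnorm
  have hy₀ : ‖y₀‖ ≤ S := (norm_snd_le (x₀, y₀)).trans hnorm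
  have hεQ1 : ε * Q < 1 := hεQ.trans_le (min_le_left _ _)
  have hεQσ : ε * Q < σ := hεQ.trans_le (min_le_right _ _)
  have hp1 : 0 ≤ ε * (2 ^ n * (2 * (D + N) / k)) := by positivity
  have hp2 : 0 ≤ ε * (2 ^ (n + 2) * (D + N) / (k * η₁) + 2 ^ (n + 2) * R / k) := by positivity
  have hsplit : ε * Q = ε * (2 ^ (n + 2) * (D + N) / (k * η₁) + 2 ^ (n + 2) * R / k)
      + ε * (2 ^ n * (2 * (D + N) / k)) := by rw [hQ]; ring
  have hmain := hs.norm_spacing_error_le hd hc.le hη₁ hw hε hr hk hkbar (R := R) (D := D)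
    (by rw [hx0]; exact (norm_sub_le _ _).trans (by linarith))
    (by rw [hy0]; linarith [norm_nonneg e]) hD
    (by rw [mul_left_comm]; linarith) (by linarith)
  refine eLpNormEssSup_le_of_ae_bound ?_ |> (le_of_eq eLpNorm_exponent_top).trans
  rw [MeasureTheory.ae_restrict_iff' measurableSet_Ici]
  refine Filter.Eventually.of_forall fun t ht => ?_
  refine (norm_le_pi_norm (x t - e) i).trans ((hmain t ht).trans ?_)
  rw [hx0]
  have hsq := Platoon.one_le_sqrt_ceil_div hr hrn
  have hdist : ε * (2 ^ (n + 2) / (k * η₁)) * N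
      ≤ ε * (2 ^ (n + 2) / (k * η₁)) * √(⌈(n : ℝ) / (r : ℝ)⌉₊ : ℝ) * N := by
    exact mul_le_mul_of_nonneg_right (le_mul_of_one_le_right (by positivity) hsq) hN0
  have hrest : ε * (2 ^ (n + 2) * (D + N) / (k * η₁) + 2 ^ (n + 2) * R / k)
      = ε * (2 ^ (n + 2) / (k * η₁)) * N
        + ε * (2 ^ (n + 2) * D / (k * η₁) + 2 ^ (n + 2) * R / k) := by ring
  have hσ' : ε * (2 ^ (n + 2) * D / (k * η₁) + 2 ^ (n + 2) * R / k) ≤ σ := by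
    have : ε * (2 ^ (n + 2) * D / (k * η₁) + 2 ^ (n + 2) * R / k)
        ≤ ε * (2 ^ (n + 2) * (D + N) / (k * η₁) + 2 ^ (n + 2) * R / k) := by
      gcongr
      linarith
    linarith
  linarith
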